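/- Let $n\ge 2$ and let $X$ be an $n$-dimensional real Banach space, with unit sphere $S_X=\{x\in X:\|x\|=1\}$, whose Banach–Mazur distance to the Euclidean space $\ell_2^n$, $$d(X,\ell_2^n)=\inf\{\|T\|\,\|T^{-1}\| : T:X\to\ell_2^n \text{ a linear isomorphism}\},$$ satisfies $d(X,\ell_2^n)\le 1+\frac{1}{3(n+1)}$. Let $\lambda\in\left(1,\,1+\frac{1}{3(n+1)}\right)$. Call a set $S\subseteq X$ $\lambda$-equilateral if $\|x-y\|=\lambda$ for all $x,y\in S$ with $x\ne y$. Then for every $\lambda$-equilateral set $S\subseteq S_X$ with at most $n-1$ points there is a $\lambda$-equilateral set $T$ with exactly $n$ points such that $S\subseteq T\subseteq S_X$. -/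

import Mathlib

/-- The Banach–Mazur distance `d(X, Y) = inf ‖T‖ ‖T⁻¹‖` of two isomorphic real normed spaces,
the infimum being over all linear isomorphisms `T : X → Y` (bounded, with bounded inverse). -/
noncomputable def banachMazurDist (X Y : Type*) [NormedAddCommGroup X] [NormedSpace ℝ X]
    [NormedAddCommGroup Y] [NormedSpace ℝ Y] : ℝ :=
  sInf {r : ℝ | ∃ T : X ≃L[ℝ] Y, r = ‖(T : X →L[ℝ] Y)‖ * ‖(T.symm : Y →L[ℝ] X)‖}

/-- `S` is `lam`-equilateral: `lam > 0`, and any two distinct points of `S` are at distance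
`lam`. -/
def IsEquilateralSet {X : Type*} [NormedAddCommGroup X] (lam : ℝ) (S : Set X) : Prop :=
  0 < lam ∧ ∀ x ∈ S, ∀ y ∈ S, x ≠ y → ‖x - y‖ = lam

/-! Points are added one at a time. Let `x i` be at most n - 1 unit vectors at mutual distance λ,
and let `A` be an isomorphism onto Euclidean space with ‖x‖ ≤ ‖A x‖ ≤ D‖x‖. The new point p must
satisfy ‖p‖ = 1 and ‖p - x i‖ = λ. Each target distance ρ is replaced by a Euclidean one, ρ(1 + z(D
- 1)), with one parameter z in [0, 1] per condition. Since all squared distances lie in [1, 1 +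
2/n], a Euclidean apex with these distances from 0 and the `A (x i)` exists and varies continuously
with the parameters (`exists_apex`). At z = 0 the distance in X is at most ρ, at z = 1 at least ρ,
so `poincare_miranda` gives parameters meeting all the conditions at once.

The apex exists because -∑ d i j c i c j is positive on nonzero vectors of sum zero
(`neg_sum_mul_pos`). Poincaré–Miranda follows from a cubical Sperner lemma, proved by a mod 2 cup
product count. -/

/-! ### Cubical Sperner lemma and the Poincaré–Miranda theorem. -/

section PoincareMiranda

open Finset Filter Topology

variable {ι : Type*} [DecidableEq ι] {R : Type*} [CommRing R]

/-- The value on the cube with lowest vertex `q` and directions `s` of the mod 2 cubical cup product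
of the coboundaries of the vertex labellings `L a`, `a` running through the list. -/
def cupSum (L : ι → (ι → ℕ) → R) : List ι → (ι → ℕ) → Finset ι → R
  | [], _, _ => 1
  | a :: l, q, s => ∑ j ∈ s, (L a (q + Pi.single j 1) + L a q) * cupSum L l (q + Pi.single j 1) (s.erase j)

theorem sum_erase_comm {M : Type*} [AddCommMonoid M] (s : Finset ι) (f : ι → ι → M) :
    ∑ j ∈ s, ∑ i ∈ s.erase j, f j i = ∑ j ∈ s, ∑ i ∈ s.erase j, f i j := by
  refine Finset.sum_comm' ?_
  intro x y
  simp only [Finset.mem_erase]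
  tauto

variable [CharP R 2]

theorem sum_erase_symm_eq_zero (s : Finset ι) (f : ι → ι → R) (hf : ∀ i j, f i j = f j i) :
    ∑ j ∈ s, ∑ i ∈ s.erase j, f j i = 0 := by
  induction s using Finset.induction_on with
  | empty => simp
  | insert a s ha ih =>
    rw [Finset.sum_insert ha, Finset.erase_insert ha]
    have : ∀ j ∈ s, ∑ i ∈ (insert a s).erase j, f j i = f j a + ∑ i ∈ s.erase j, f j i := by
      intro j hj
      have hja : a ≠ j := fun h => ha (h ▸ hj)
      rw [Finset.erase_insert_of_ne hja, Finset.sum_insert (by simp [ha])]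
    rw [Finset.sum_congr rfl this, Finset.sum_add_distrib, ih, add_zero,
      Finset.sum_congr rfl (fun j _ => hf j a), CharTwo.add_self_eq_zero]

/-- A cup product of coboundaries is a cocycle. -/
theorem cupSum_cocycle (L : ι → (ι → ℕ) → R) (l : List ι) :
    ∀ (q : ι → ℕ) (s : Finset ι),
      (l.length + 1 = s.card) →
      ∑ j ∈ s, (cupSum L l (q + Pi.single j 1) (s.erase j) + cupSum L l q (s.erase j)) = 0 := by
  induction l with
  | nil => intro q s _; simp [cupSum, CharTwo.add_self_eq_zero]
  | cons a l ih =>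
    intro q s hs
    have hs' : ∀ j ∈ s, l.length + 1 = (s.erase j).card := by
      intro j hj
      rw [Finset.card_erase_of_mem hj, ← hs]; simp
    -- The first product is symmetric in `i` and `j`, so its sum cancels mod 2. The middle pair and
    -- the last product are handled by the induction hypothesis, based at `q + Pi.single j 1` and at
    -- `q`.
    have key : ∀ j ∈ s, ∀ i ∈ s.erase j,
        (L a (q + Pi.single j 1 + Pi.single i 1) + L a (q + Pi.single j 1)) *
            cupSum L l (q + Pi.single j 1 + Pi.single i 1) ((s.erase j).erase i) +
          (L a (q + Pi.single i 1) + L a q) * cupSum L l (q + Pi.single i 1) ((s.erase j).erase i) =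
        L a (q + Pi.single j 1 + Pi.single i 1) *
            cupSum L l (q + Pi.single j 1 + Pi.single i 1) ((s.erase j).erase i) +
        (L a (q + Pi.single j 1) * cupSum L l (q + Pi.single j 1 + Pi.single i 1) ((s.erase j).erase i) +
          L a (q + Pi.single i 1) * cupSum L l (q + Pi.single i 1) ((s.erase i).erase j)) +
        L a q * cupSum L l (q + Pi.single i 1) ((s.erase j).erase i) := by
      intro j _ i _
      rw [Finset.erase_right_comm (a := i) (b := j)]
      ring
    simp only [cupSum]
    simp_rw [← Finset.sum_add_distrib]
    rw [Finset.sum_congr rfl fun j hj => Finset.sum_congr rfl (key j hj)]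
    simp_rw [Finset.sum_add_distrib]
    have e1 := sum_erase_symm_eq_zero s (fun j i => L a (q + Pi.single j 1 + Pi.single i 1) *
            cupSum L l (q + Pi.single j 1 + Pi.single i 1) ((s.erase j).erase i))
        (fun i j => by rw [Finset.erase_right_comm, add_right_comm])
    have e2 := sum_erase_comm s (fun j i => L a (q + Pi.single i 1) *
        cupSum L l (q + Pi.single i 1) ((s.erase i).erase j))
    rw [e1, zero_add, e2]
    have e3 : ∀ j ∈ s, ∑ i ∈ s.erase j, L a (q + Pi.single j 1) *
          cupSum L l (q + Pi.single j 1 + Pi.single i 1) ((s.erase j).erase i) +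
        ∑ i ∈ s.erase j, L a (q + Pi.single j 1) *
          cupSum L l (q + Pi.single j 1) ((s.erase j).erase i) = 0 := by
      intro j hj
      rw [← Finset.mul_sum, ← Finset.mul_sum, ← mul_add, ← Finset.sum_add_distrib,
        ih _ _ (hs' j hj), mul_zero]
    rw [← Finset.sum_add_distrib, Finset.sum_eq_zero e3, zero_add,
      Finset.sum_congr rfl fun j _ => (Finset.mul_sum _ _ (L a q)).symm, ← Finset.mul_sum]
    have h2 : ∑ j ∈ s, ∑ i ∈ s.erase j, (cupSum L l (q + Pi.single i 1) ((s.erase j).erase i) +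
        cupSum L l q ((s.erase j).erase i)) = 0 :=
      Finset.sum_eq_zero fun j hj => ih q _ (hs' j hj)
    simp_rw [Finset.sum_add_distrib] at h2
    rw [sum_erase_symm_eq_zero s (fun j i => cupSum L l q ((s.erase j).erase i))
      (fun i j => by rw [Finset.erase_right_comm]), add_zero] at h2
    rw [h2, mul_zero]

/-- Only edges with directions in `s` occur, so coordinate `j` never changes and the factor coming
from `b` is zero. -/
theorem cupSum_eq_zero_of_face (L : ι → (ι → ℕ) → R) (b j : ι) (l : List ι) (hb : b ∈ l) :
    ∀ (q : ι → ℕ) (s : Finset ι), j ∉ s → (∀ v w : ι → ℕ, v j = q j → w j = q j → L b v = L b w) →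
      cupSum L l q s = 0 := by
  induction l with
  | nil => simp at hb
  | cons a l ih =>
    intro q s hj hc
    rw [cupSum]
    refine Finset.sum_eq_zero fun i hi => ?_
    have hij : j ≠ i := fun h => hj (h ▸ hi)
    have hq : (q + Pi.single i 1 : ι → ℕ) j = q j := by simp [hij]
    rcases List.mem_cons.1 hb with rfl | hb
    · rw [hc _ q hq rfl, CharTwo.add_self_eq_zero, zero_mul]
    · rw [ih hb _ _ (by simp [hj]) (by rw [hq]; exact hc), mul_zero]

theorem exists_ne_of_cupSum_ne_zero (L : ι → (ι → ℕ) → R) (l : List ι) :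
    ∀ (q : ι → ℕ) (s : Finset ι), cupSum L l q s ≠ 0 → ∀ a ∈ l, ∃ v w : ι → ℕ,
      (∀ i, q i ≤ v i ∧ v i ≤ q i + if i ∈ s then 1 else 0) ∧
      (∀ i, q i ≤ w i ∧ w i ≤ q i + if i ∈ s then 1 else 0) ∧ L a v ≠ L a w := by
  induction l with
  | nil => simp
  | cons b l ih =>
    intro q s h a ha
    rw [cupSum] at h
    obtain ⟨j, hj, hne⟩ := Finset.exists_ne_zero_of_sum_ne_zero h
    rcases List.mem_cons.1 ha with rfl | ha
    · refine ⟨q + Pi.single j 1, q, fun i => ?_, fun i => by simp, fun heq => hne ?_⟩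
      · rcases eq_or_ne i j with rfl | hij
        · simp [hj]
        · simp [hij]
      · rw [heq, CharTwo.add_self_eq_zero, zero_mul]
    · obtain ⟨v, w, hv, hw, hvw⟩ := ih _ _ (right_ne_zero_of_mul hne) a ha
      have aux : ∀ v : ι → ℕ, (∀ i, (q + Pi.single j 1 : ι → ℕ) i ≤ v i ∧
          v i ≤ (q + Pi.single j 1 : ι → ℕ) i + if i ∈ s.erase j then 1 else 0) →
          ∀ i, q i ≤ v i ∧ v i ≤ q i + if i ∈ s then 1 else 0 := by
        intro v hv i
        have := hv i
        rcases eq_or_ne i j with rfl | hij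
        · simp [hj] at this ⊢; omega
        · simpa [hij] using this
      exact ⟨v, w, aux v hv, aux w hw, hvw⟩

variable [Fintype ι]

/-- Lowest vertices of the cubes with directions `s` of the face `x i = N`, `i ∉ s`, of the grid. -/
def gridFace (N : ℕ) (s : Finset ι) : Finset (ι → ℕ) :=
  Fintype.piFinset fun i => if i ∈ s then range N else {N}

theorem sum_gridFace {M : Type*} [AddCommMonoid M] {N : ℕ} {s : Finset ι} {j : ι} (hj : j ∈ s)
    (f : (ι → ℕ) → M) :
    ∑ q ∈ gridFace N s, f q = ∑ q ∈ gridFace N (s.erase j), ∑ t ∈ range N, f (Function.update q j t) := by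
  rw [Finset.sum_sigma']
  symm
  refine Finset.sum_bij' (fun x _ => Function.update x.1 j x.2)
    (fun q _ => ⟨Function.update q j N, q j⟩) ?_ ?_ ?_ ?_ ?_
  · rintro ⟨q, t⟩ h
    simp only [Finset.mem_sigma, gridFace, Fintype.mem_piFinset] at h ⊢
    intro i
    rcases eq_or_ne i j with rfl | hij
    · simpa [hj] using h.2
    · simpa [hij] using h.1 i
  · intro q h
    simp only [Finset.mem_sigma, gridFace, Fintype.mem_piFinset] at h ⊢
    refine ⟨fun i => ?_, by simpa [hj] using h j⟩
    rcases eq_or_ne i j with rfl | hij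
    · simp
    · simpa [hij] using h i
  · rintro ⟨q, t⟩ h
    simp only [Finset.mem_sigma, gridFace, Fintype.mem_piFinset] at h
    have := h.1 j
    simp only [Finset.mem_erase, ne_eq, not_true, false_and, if_false, Finset.mem_singleton] at this
    simp [← this]
  · intro q h
    simp
  · rintro ⟨q, t⟩ h
    rfl

/-- Stokes in direction `j`: only the two opposite faces survive. -/
theorem sum_gridFace_telescope {N : ℕ} {s : Finset ι} {j : ι} (hj : j ∈ s) (f : (ι → ℕ) → R) :
    ∑ q ∈ gridFace N s, (f (q + Pi.single j 1) + f q) =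
      ∑ q ∈ gridFace N (s.erase j), (f q + f (Function.update q j 0)) := by
  rw [sum_gridFace hj]
  refine Finset.sum_congr rfl fun q hq => ?_
  have h1 : ∀ t, Function.update q j t + Pi.single j 1 = Function.update q j (t + 1) := by
    intro t; ext i
    rcases eq_or_ne i j with rfl | hij
    · simp
    · simp [hij]
  simp_rw [h1]
  have h2 := Finset.sum_range_sub (fun t => f (Function.update q j t)) N
  simp_rw [CharTwo.sub_eq_add] at h2
  rw [h2]
  have : q j = N := by
    simp only [gridFace, Fintype.mem_piFinset] at hq
    simpa using hq j
  rw [← this, Function.update_eq_self]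

/-- By the cocycle property the integrand is the coboundary of `L a` times the remaining product, so
the sum moves to the boundary. On faces normal to `j ≠ a` the label `L j` is constant and the
product vanishes; on `q a = 0` the factor `L a` vanishes; the face `q a = N` gives the sum for the
shorter list. -/
theorem sum_cupSum_eq_one (L : ι → (ι → ℕ) → R) (N : ℕ)
    (h0 : ∀ i q, q i = 0 → L i q = 0) (h1 : ∀ i q, q i = N → L i q = 1) (l : List ι) (hl : l.Nodup) :
    ∑ q ∈ gridFace N l.toFinset, cupSum L l q l.toFinset = 1 := by
  induction l with
  | nil => simp [cupSum, gridFace]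
  | cons a l ih =>
    set s := (a :: l).toFinset with hs
    have has : a ∈ s := by simp [hs]
    have hal : a ∉ l := (List.nodup_cons.1 hl).1
    have hsa : s.erase a = l.toFinset := by
      rw [hs, List.toFinset_cons, Finset.erase_insert (by simpa using hal)]
    have hcard : l.length + 1 = s.card := by rw [hs, List.toFinset_card_of_nodup hl]; simp
    have key : ∀ q, cupSum L (a :: l) q s = ∑ j ∈ s,
        (L a (q + Pi.single j 1) * cupSum L l (q + Pi.single j 1) (s.erase j) +
          L a q * cupSum L l q (s.erase j)) := by
      intro q
      have h := cupSum_cocycle L l q s hcard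
      have h3 : L a q * ∑ j ∈ s, (cupSum L l (q + Pi.single j 1) (s.erase j) +
        cupSum L l q (s.erase j)) = 0 := by rw [h, mul_zero]
      rw [cupSum, ← add_zero (∑ j ∈ s, _), ← h3, Finset.mul_sum, ← Finset.sum_add_distrib]
      refine Finset.sum_congr rfl fun j _ => ?_
      linear_combination CharTwo.add_self_eq_zero (L a q * cupSum L l (q + Pi.single j 1) (s.erase j))
    simp_rw [key]
    rw [Finset.sum_comm, Finset.sum_congr rfl fun j hj =>
      sum_gridFace_telescope hj (fun q => L a q * cupSum L l q (s.erase j)),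
      Finset.sum_eq_single_of_mem a has]
    · rw [← ih (List.nodup_cons.1 hl).2, ← hsa]
      refine Finset.sum_congr rfl fun q hq => ?_
      have hq' : q a = N := by
        simp only [gridFace, Fintype.mem_piFinset] at hq
        simpa using hq a
      rw [h1 a q hq', h0 a _ (by simp), one_mul, zero_mul, add_zero]
    · intro j hj hja
      have hjl : j ∈ l := by
        have := (Finset.mem_erase.2 ⟨hja, hj⟩); rw [hsa] at this; simpa using this
      refine Finset.sum_eq_zero fun q hq => ?_
      have hq' : q j = N := by
        simp only [gridFace, Fintype.mem_piFinset] at hq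
        simpa using hq j
      rw [cupSum_eq_zero_of_face L j j l hjl q _ (by simp)
          (fun v w hv hw => by rw [h1 j v (hv.trans hq'), h1 j w (hw.trans hq')]),
        cupSum_eq_zero_of_face L j j l hjl (Function.update q j 0) _ (by simp)
          (fun v w hv hw => by rw [h0 j v (by simpa using hv), h0 j w (by simpa using hw)])]
      simp

/-- Kuhn's cubical form of Sperner's lemma. -/
theorem exists_cube_all_labels (L : ι → (ι → ℕ) → ZMod 2) (N : ℕ)
    (h0 : ∀ i q, q i = 0 → L i q = 0) (h1 : ∀ i q, q i = N → L i q = 1) :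
    ∃ q : ι → ℕ, (∀ i, q i < N) ∧ ∀ a, ∃ v w : ι → ℕ, (∀ i, q i ≤ v i ∧ v i ≤ q i + 1) ∧
      (∀ i, q i ≤ w i ∧ w i ≤ q i + 1) ∧ L a v = 0 ∧ L a w = 1 := by
  have h := sum_cupSum_eq_one L N h0 h1 (univ : Finset ι).toList (Finset.nodup_toList _)
  rw [Finset.toList_toFinset] at h
  obtain ⟨q, hq, hne⟩ := Finset.exists_ne_zero_of_sum_ne_zero (h.trans_ne one_ne_zero)
  refine ⟨q, fun i => ?_, fun a => ?_⟩
  · simp only [gridFace, Fintype.mem_piFinset] at hq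
    simpa using hq i
  · obtain ⟨v, w, hv, hw, hvw⟩ := exists_ne_of_cupSum_ne_zero L _ q _ hne a (by simp)
    simp only [Finset.mem_univ, if_true] at hv hw
    have dich : ∀ x : ZMod 2, x = 0 ∨ x = 1 := by decide
    rcases dich (L a v) with h | h <;> rcases dich (L a w) with h' | h'
    · exact absurd (h.trans h'.symm) hvw
    · exact ⟨v, w, hv, hw, h, h'⟩
    · exact ⟨w, v, hw, hv, h', h⟩
    · exact absurd (h.trans h'.symm) hvw

/-- The **Poincaré–Miranda theorem**. -/
theorem poincare_miranda (F : ι → (ι → ℝ) → ℝ) (hF : ∀ i, ContinuousOn (F i) (Set.Icc 0 1))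
    (h0 : ∀ i, ∀ x ∈ Set.Icc (0 : ι → ℝ) 1, x i = 0 → F i x ≤ 0)
    (h1 : ∀ i, ∀ x ∈ Set.Icc (0 : ι → ℝ) 1, x i = 1 → 0 ≤ F i x) :
    ∃ x ∈ Set.Icc (0 : ι → ℝ) 1, ∀ i, F i x = 0 := by
  classical
  let g : ℕ → (ι → ℕ) → ι → ℝ := fun N q i => (q i : ℝ) / ((N + 1 : ℕ) : ℝ)
  have hg : ∀ N (q v : ι → ℕ), (∀ i, q i < N + 1) → (∀ i, q i ≤ v i ∧ v i ≤ q i + 1) →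
      g N v ∈ Set.Icc (0 : ι → ℝ) 1 := by
    intro N q v hq hv
    refine ⟨fun i => by positivity, fun i => ?_⟩
    have := hq i
    have := hv i
    have h : v i ≤ N + 1 := by omega
    exact div_le_one_of_le₀ (Nat.cast_le.2 h) (by positivity)
  have hdist : ∀ N (q v : ι → ℕ), (∀ i, q i ≤ v i ∧ v i ≤ q i + 1) →
      dist (g N v) (g N q) ≤ 1 / ((N + 1 : ℕ) : ℝ) := by
    intro N q v hv
    refine (dist_pi_le_iff (by positivity)).2 fun i => ?_
    have h1 : (q i : ℝ) ≤ v i := by exact_mod_cast (hv i).1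
    have h2 : (v i : ℝ) ≤ q i + 1 := by exact_mod_cast (hv i).2
    rw [Real.dist_eq, ← sub_div, abs_of_nonneg (div_nonneg (by linarith) (by positivity))]
    gcongr
    linarith
  have step : ∀ N : ℕ, ∃ q : ι → ℕ, (∀ i, q i < N + 1) ∧ ∀ a, ∃ v w : ι → ℕ,
      (∀ i, q i ≤ v i ∧ v i ≤ q i + 1) ∧ (∀ i, q i ≤ w i ∧ w i ≤ q i + 1) ∧
      F a (g N v) ≤ 0 ∧ 0 ≤ F a (g N w) := by
    intro N
    obtain ⟨q, hq, h⟩ := exists_cube_all_labels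
      -- Labels on the boundary are forced; the sign hypotheses on opposite faces make them agree
      -- with the weak sign of `F i`.
      (fun i q => if q i = 0 then 0 else if q i = N + 1 then 1 else if F i (g N q) ≤ 0 then 0 else 1)
      (N + 1) (fun i q h => by simp [h]) (fun i q h => by simp [h])
    refine ⟨q, hq, fun a => ?_⟩
    obtain ⟨v, w, hv, hw, hva, hwa⟩ := h a
    refine ⟨v, w, hv, hw, ?_, ?_⟩
    · by_cases c0 : v a = 0
      · exact h0 a _ (hg N q v hq hv) (by simp [g, c0])
      · by_contra hcon
        by_cases c1 : v a = N + 1 <;> simp [c0, c1, hcon] at hva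
    · by_cases c1 : w a = N + 1
      · exact h1 a _ (hg N q w hq hw) (by simp only [g, c1]; exact div_self (by positivity))
      · by_cases c0 : w a = 0
        · simp [c0] at hwa
        · by_contra hcon
          simp [c0, c1, (not_le.1 hcon).le] at hwa
  choose q hq v w hv hw hFv hFw using step
  obtain ⟨x, hx, φ, hφ, hlim⟩ := (isCompact_Icc (a := (0 : ι → ℝ)) (b := 1)).tendsto_subseq
    (x := fun N => g N (q N)) (fun N => hg N (q N) (q N) (hq N) (fun i => ⟨le_rfl, Nat.le_succ _⟩))
  have hconv : ∀ u : ℕ → ι → ℕ, (∀ N i, q N i ≤ u N i ∧ u N i ≤ q N i + 1) →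
      Tendsto (fun k => g (φ k) (u (φ k))) atTop (𝓝[Set.Icc 0 1] x) := by
    intro u hu
    refine tendsto_nhdsWithin_iff.2 ⟨?_, Eventually.of_forall fun k => hg _ _ _ (hq _) (hu _)⟩
    refine (tendsto_iff_of_dist ?_).1 hlim
    have hz : Tendsto (fun k => 1 / (((φ k) + 1 : ℕ) : ℝ)) atTop (𝓝 0) :=
      (((tendsto_const_div_atTop_nhds_zero_nat (1 : ℝ)).comp (tendsto_add_atTop_nat 1))).comp
        hφ.tendsto_atTop
    refine squeeze_zero (fun _ => dist_nonneg) (fun k => ?_) hz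
    rw [dist_comm]
    exact hdist _ _ _ (hu _)
  refine ⟨x, hx, fun i => le_antisymm ?_ ?_⟩
  · exact le_of_tendsto ((hF i x hx).tendsto.comp (hconv (fun N => v N i) fun N => hv N i))
      (Eventually.of_forall fun k => hFv (φ k) i)
  · exact ge_of_tendsto ((hF i x hx).tendsto.comp (hconv (fun N => w N i) fun N => hw N i))
      (Eventually.of_forall fun k => hFw (φ k) i)

end PoincareMiranda

/-! ### Almost regular Euclidean simplices. -/

section Simplex

open Finset

/-- For an almost constant off-diagonal matrix `d`, `-∑ d i j c i c j` is positive on nonzero vectors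
of coordinate sum zero. -/
theorem neg_sum_mul_pos {ι : Type*} [Fintype ι] (d : ι → ι → ℝ) (n : ℕ)
    (hn : 1 ≤ n) (hcard : Fintype.card ι ≤ n + 1) (hdiag : ∀ i, d i i = 0)
    (hd : ∀ i j, i ≠ j → d i j ∈ Set.Icc (1 : ℝ) (1 + 2 / n)) (c : ι → ℝ) (hc : ∑ i, c i = 0)
    (hne : ∃ i, c i ≠ 0) : 0 < -∑ i, ∑ j, c i * c j * d i j := by
  classical
  have hn' : (0 : ℝ) < n := by exact_mod_cast hn
  set η : ℝ := 1 / n with hη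
  have hη2 : (2 : ℝ) / n = 2 * η := by rw [hη]; ring
  have hηpos : 0 < η := by positivity
  -- Compare `d` with the midpoint 1 + η of its range: off-diagonal errors are at most η, and AM-GM
  -- bounds the products. As there are at most n + 1 indices, summation leaves at least η ∑ c i ^ 2.
  have term : ∀ i j, (if i = j then (1 + 2 * η) * c i ^ 2 else 0) - η / 2 * (c i ^ 2 + c j ^ 2)
      ≤ (1 + η) * (c i * c j) - c i * c j * d i j := by
    intro i j
    split_ifs with h
    · subst h; rw [hdiag]; nlinarith
    · obtain ⟨h1, h2⟩ := hd i j h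
      rw [hη2] at h2
      have h3 : |1 + η - d i j| ≤ η := abs_le.2 ⟨by linarith, by linarith⟩
      have h4 : |c i * c j| ≤ (c i ^ 2 + c j ^ 2) / 2 := by
        rw [abs_mul]; nlinarith [sq_nonneg (|c i| - |c j|), sq_abs (c i), sq_abs (c j)]
      have h5 : |(1 + η - d i j) * (c i * c j)| ≤ η * ((c i ^ 2 + c j ^ 2) / 2) := by
        rw [abs_mul]; exact mul_le_mul h3 h4 (abs_nonneg _) hηpos.le
      have := (abs_le.1 h5).1
      linarith
  have hsum := Finset.sum_le_sum fun i (_ : i ∈ univ) =>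
    Finset.sum_le_sum fun j (_ : j ∈ univ) => term i j
  simp only [Finset.sum_sub_distrib, Finset.sum_ite_eq, Finset.mem_univ, if_true, ← Finset.mul_sum,
    Finset.sum_add_distrib, Finset.sum_const, Finset.card_univ, nsmul_eq_mul, hc, mul_zero,
    zero_sub, Finset.sum_neg_distrib] at hsum
  have hpos : 0 < ∑ i, c i ^ 2 := by
    obtain ⟨i, hi⟩ := hne
    exact Finset.sum_pos' (fun i _ => sq_nonneg _) ⟨i, mem_univ i, by positivity⟩
  have hcard' : (Fintype.card ι : ℝ) ≤ n + 1 := by exact_mod_cast hcard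
  have hηn : η * n = 1 := by rw [hη]; field_simp
  refine lt_of_lt_of_le ?_ hsum
  have h6 : η * Fintype.card ι ≤ η * (n + 1) := by gcongr
  nlinarith

variable {E : Type*} [NormedAddCommGroup E] [InnerProductSpace ℝ E]

theorem sum_mul_dist_sq_eq {ι : Type*} [Fintype ι] (v : ι → E) (c : ι → ℝ) (hc : ∑ i, c i = 0) :
    ∑ i, ∑ j, c i * c j * ‖v i - v j‖ ^ 2 = -2 * ‖∑ i, c i • v i‖ ^ 2 := by
  have h := inner_sum_smul_sum_smul_of_sum_eq_zero v hc v hc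
  rw [real_inner_self_eq_norm_sq] at h
  simp_rw [pow_two] at h ⊢
  linarith

/-- The nonzero vertices of an almost regular simplex with a vertex at the origin are linearly
independent. -/
theorem linearIndependent_of_dist_sq {σ : Type*} [Fintype σ] (n : ℕ) (hn : 1 ≤ n)
    (hcard : Fintype.card σ ≤ n) (x : σ → E)
    (hx : ∀ i, ‖x i‖ ^ 2 ∈ Set.Icc (1 : ℝ) (1 + 2 / n))
    (hxx : ∀ i j, i ≠ j → ‖x i - x j‖ ^ 2 ∈ Set.Icc (1 : ℝ) (1 + 2 / n)) :
    LinearIndependent ℝ x := by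
  rw [Fintype.linearIndependent_iff]
  intro g hg
  by_contra! hne
  obtain ⟨i, hi⟩ := hne
  -- A linear relation among the `x i` becomes an affine relation with the origin adjoined, on which
  -- the form would vanish.
  let v : Option σ → E := fun o => o.elim 0 x
  let c : Option σ → ℝ := fun o => o.elim (-∑ i, g i) g
  have hc : ∑ i, c i = 0 := by simp [c, Fintype.sum_option]
  have h := neg_sum_mul_pos (fun i j => ‖v i - v j‖ ^ 2) n hn (by simpa using hcard)
    (fun i => by simp) ?_ c hc ⟨some i, hi⟩
  · rw [sum_mul_dist_sq_eq v c hc, Fintype.sum_option] at h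
    simp [v, c, hg] at h
  · rintro (_ | i) (_ | j) hij
    · exact absurd rfl hij
    · simpa [v] using hx j
    · simpa [v] using hx i
    · exact hxx i j fun h => hij (h ▸ rfl)

theorem LinearIndependent.exists_dual_vectors {σ : Type*} [Finite σ] [DecidableEq σ] {x : σ → E}
    (hx : LinearIndependent ℝ x) :
    ∃ y : σ → E, (∀ i, y i ∈ Submodule.span ℝ (Set.range x)) ∧
      ∀ i j, inner ℝ (y i) (x j) = if i = j then (1 : ℝ) else 0 := by
  set W := Submodule.span ℝ (Set.range x)
  let b : Module.Basis σ ℝ W := Module.Basis.span hx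
  have : FiniteDimensional ℝ W := Module.Finite.of_basis b
  refine ⟨fun i => ((InnerProductSpace.toDual ℝ W).symm (LinearMap.toContinuousLinearMap (b.coord i)) : W),
    fun i => Subtype.property _, fun i j => ?_⟩
  have hb : x j = (b j : E) := (congrArg Subtype.val (Module.Basis.span_apply hx j)).symm
  rw [hb, ← Submodule.coe_inner, InnerProductSpace.toDual_symm_apply]
  simp [Finsupp.single_apply, eq_comm]

/-- Over a base of an almost regular simplex with a vertex at the origin, the apex can be chosen
continuously in terms of its squared distances from the vertices of the base. -/
theorem exists_apex {σ : Type*} [Fintype σ] [FiniteDimensional ℝ E] (n : ℕ)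
    (hdim : Module.finrank ℝ E = n) (hcard : Fintype.card σ + 1 ≤ n) (x : σ → E)
    (hx : ∀ i, ‖x i‖ ^ 2 ∈ Set.Icc (1 : ℝ) (1 + 2 / n))
    (hxx : ∀ i j, i ≠ j → ‖x i - x j‖ ^ 2 ∈ Set.Icc (1 : ℝ) (1 + 2 / n)) :
    ∃ p : (Option σ → ℝ) → E, Continuous p ∧
      ∀ s : Option σ → ℝ, (∀ o, s o ∈ Set.Icc (1 : ℝ) (1 + 2 / n)) →
        ∀ o : Option σ, ‖p s - o.elim 0 x‖ ^ 2 = s o := by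
  classical
  have hn : 1 ≤ n := by omega
  have hli := linearIndependent_of_dist_sq n hn (by omega) x hx hxx
  obtain ⟨y, hyW, hy⟩ := hli.exists_dual_vectors
  set W := Submodule.span ℝ (Set.range x) with hW
  obtain ⟨u, huW, hu⟩ : ∃ u ∈ Wᗮ, ‖u‖ = 1 := by
    have hlt : Module.finrank ℝ W < Module.finrank ℝ E := by
      rw [hW, finrank_span_eq_card hli]; omega
    have hbot : Wᗮ ≠ ⊥ := fun h => by
      rw [Submodule.orthogonal_eq_bot_iff] at h
      rw [h, finrank_top] at hlt
      exact lt_irrefl _ hlt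
    obtain ⟨u, hu, hu0⟩ := Submodule.exists_mem_ne_zero_of_ne_bot hbot
    exact ⟨(‖u‖⁻¹ : ℝ) • u, Submodule.smul_mem _ _ hu, by
      rw [norm_smul, norm_inv, norm_norm, inv_mul_cancel₀ (norm_ne_zero_iff.2 hu0)]⟩
  -- The prescribed distances determine the inner products of the apex with the `x i`, hence its
  -- projection `q s` to `W`; the squared height is `s none - ‖q s‖ ^ 2`.
  let b : (Option σ → ℝ) → σ → ℝ := fun s i => (s none + ‖x i‖ ^ 2 - s (some i)) / 2
  let q : (Option σ → ℝ) → E := fun s => ∑ i, b s i • y i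
  have hqc : Continuous q := by fun_prop
  have hqx : ∀ s i, inner ℝ (q s) (x i) = b s i := by
    intro s i
    simp [q, sum_inner, real_inner_smul_left, hy]
  have hqW : ∀ s, q s ∈ W := fun s => Submodule.sum_mem _ fun i _ => Submodule.smul_mem _ _ (hyW i)
  have hqd : ∀ s i, ‖q s - x i‖ ^ 2 = s (some i) - (s none - ‖q s‖ ^ 2) := by
    intro s i
    rw [norm_sub_sq_real, hqx]; simp only [b]; ring
  refine ⟨fun s => q s + √(s none - ‖q s‖ ^ 2) • u, by fun_prop, fun s hs => ?_⟩
  have hh : 0 < s none - ‖q s‖ ^ 2 := by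
    obtain ⟨g, hg⟩ := (Submodule.mem_span_range_iff_exists_fun ℝ).1 (hqW s)
    let v : Option (Option σ) → E := fun o => o.elim (q s) fun o => o.elim 0 x
    let c : Option (Option σ) → ℝ := fun o => o.elim (-1) fun o => o.elim (1 - ∑ i, g i) g
    have hc : ∑ i, c i = 0 := by simp [c, Fintype.sum_option]
    -- The prescribed squared distances exceed those from `q s` by the squared height, in the apex
    -- row and column only. With `c` made of -1 and the barycentric coordinates of `q s`, the
    -- positive form equals twice the squared height.
    let d : Option (Option σ) → Option (Option σ) → ℝ
      | none, none => 0
      | none, some o => s o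
      | some o, none => s o
      | some o, some o' => ‖v (some o) - v (some o')‖ ^ 2
    have h := neg_sum_mul_pos d n hn (by simpa using hcard) ?_ ?_ c hc ⟨none, by simp [c]⟩
    · have h2 := sum_mul_dist_sq_eq v c hc
      have hz : ∑ i, c i • v i = 0 := by simp [Fintype.sum_option, c, v, hg]
      rw [hz, norm_zero] at h2
      have hd0 : ∀ o, s o = ‖v none - v (some o)‖ ^ 2 + (s none - ‖q s‖ ^ 2) := by
        rintro (_ | i)
        · simp [v]
        · have := hqd s i
          simp only [v, Option.elim]; linarith
      have hd1 : ∀ i j, d i j = ‖v i - v j‖ ^ 2 + (s none - ‖q s‖ ^ 2) *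
          ((if i = none then 1 else 0) + (if j = none then 1 else 0) -
            2 * ((if i = none then 1 else 0) * (if j = none then 1 else 0))) := by
        rintro (_ | i) (_ | j)
        · simp [d]; right; norm_num
        · simp only [d]; rw [hd0]; simp
        · simp only [d]; rw [hd0, norm_sub_rev]; simp
        · simp [d]
      have h3 : ∑ i, ∑ j, c i * c j * d i j = -2 * (s none - ‖q s‖ ^ 2) := by
        have e1 : ∀ i j, c i * c j * d i j = c i * c j * ‖v i - v j‖ ^ 2 + (s none - ‖q s‖ ^ 2) *
          ((if i = none then c i else 0) * c j + c i * (if j = none then c j else 0) -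
            2 * ((if i = none then c i else 0) * (if j = none then c j else 0))) := by
          intro i j; rw [hd1]; split_ifs <;> ring
        simp_rw [e1, Finset.sum_add_distrib, h2, ← Finset.mul_sum, Finset.sum_sub_distrib,
          Finset.sum_add_distrib, ← Finset.mul_sum, ← Finset.sum_mul, hc]
        simp [c]
        ring
      rw [h3] at h
      linarith
    · rintro (_ | o) <;> simp [d]
    · rintro (_ | o) (_ | o') hoo
      · exact absurd rfl hoo
      · exact hs o'
      · exact hs o
      · have hoo' : o ≠ o' := fun h => hoo (h ▸ rfl)
        simp only [d, v, Option.elim]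
        rcases o with _ | i <;> rcases o' with _ | j
        · exact absurd rfl hoo'
        · simpa using hx j
        · simpa using hx i
        · exact hxx i j fun h => hoo' (h ▸ rfl)
  have hxu : ∀ w ∈ W, inner ℝ u w = 0 := fun w hw => by
    rw [real_inner_comm]; exact (Submodule.mem_orthogonal _ _).1 huW w hw
  have hsq : ∀ w ∈ W, ‖q s + √(s none - ‖q s‖ ^ 2) • u - w‖ ^ 2 =
      ‖q s - w‖ ^ 2 + (s none - ‖q s‖ ^ 2) := by
    intro w hw
    have : inner ℝ (q s - w) u = 0 := by
      rw [real_inner_comm]; exact hxu _ (Submodule.sub_mem _ (hqW s) hw)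
    rw [add_sub_right_comm, norm_add_sq_real, real_inner_smul_right, this, norm_smul, hu,
      Real.norm_eq_abs, mul_one, sq_abs, Real.sq_sqrt hh.le]
    ring
  rintro (_ | i)
  · simp only [Option.elim]
    rw [hsq 0 (Submodule.zero_mem _)]; simp
  · simp only [Option.elim]
    rw [hsq (x i) (Submodule.subset_span ⟨i, rfl⟩), hqd]; ring

end Simplex

/-! ### Extending an equilateral set by one point. -/

section EquilateralSets

theorem exists_continuousLinearEquiv_norm_bounds {n : ℕ} {X : Type*} [NormedAddCommGroup X]
    [NormedSpace ℝ X] [FiniteDimensional ℝ X] [Nontrivial X] (hdim : Module.finrank ℝ X = n)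
    {D : ℝ} (hD : banachMazurDist X (EuclideanSpace ℝ (Fin n)) < D) :
    ∃ A : X ≃L[ℝ] EuclideanSpace ℝ (Fin n), ∀ x, ‖x‖ ≤ ‖A x‖ ∧ ‖A x‖ ≤ D * ‖x‖ := by
  let T₀ : X ≃L[ℝ] EuclideanSpace ℝ (Fin n) :=
    ContinuousLinearEquiv.ofFinrankEq (by simp [hdim])
  have hne : {r : ℝ | ∃ T : X ≃L[ℝ] EuclideanSpace ℝ (Fin n),
      r = ‖(T : X →L[ℝ] EuclideanSpace ℝ (Fin n))‖ *
        ‖(T.symm : EuclideanSpace ℝ (Fin n) →L[ℝ] X)‖}.Nonempty := ⟨_, T₀, rfl⟩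
  obtain ⟨_, ⟨T, rfl⟩, hT⟩ := exists_lt_of_csInf_lt hne hD
  have hpos : 0 < ‖(T.symm : EuclideanSpace ℝ (Fin n) →L[ℝ] X)‖ := by
    obtain ⟨x, hx⟩ := exists_ne (0 : X)
    refine norm_pos_iff.2 fun h => hx ?_
    have := DFunLike.congr_fun h (T x)
    simpa using this
  -- Scaling by ‖T⁻¹‖ makes the lower bound exactly ‖x‖.
  refine ⟨T.trans (ContinuousLinearEquiv.smulLeft (Units.mk0 _ hpos.ne')), fun x => ?_⟩
  have hA : (T.trans (ContinuousLinearEquiv.smulLeft (Units.mk0 _ hpos.ne'))) x =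
      ‖(T.symm : EuclideanSpace ℝ (Fin n) →L[ℝ] X)‖ • T x := rfl
  rw [hA, norm_smul, norm_norm]
  constructor
  · simpa using (T.symm : EuclideanSpace ℝ (Fin n) →L[ℝ] X).le_opNorm (T x)
  · calc _ ≤ ‖(T.symm : EuclideanSpace ℝ (Fin n) →L[ℝ] X)‖ *
          (‖(T : X →L[ℝ] EuclideanSpace ℝ (Fin n))‖ * ‖x‖) := by
            gcongr; exact (T : X →L[ℝ] EuclideanSpace ℝ (Fin n)).le_opNorm x
      _ = ‖(T : X →L[ℝ] EuclideanSpace ℝ (Fin n))‖ *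
          ‖(T.symm : EuclideanSpace ℝ (Fin n) →L[ℝ] X)‖ * ‖x‖ := by ring
      _ ≤ D * ‖x‖ := by gcongr

theorem exists_norm_sub_eq {n : ℕ} {X E σ : Type*} [NormedAddCommGroup X] [NormedSpace ℝ X]
    [NormedAddCommGroup E] [InnerProductSpace ℝ E] [FiniteDimensional ℝ E] [Fintype σ]
    (hdim : Module.finrank ℝ E = n) (hcard : Fintype.card σ + 1 ≤ n) {D lam : ℝ} (hD : 1 ≤ D)
    (hlam : 1 ≤ lam) (hDlam : (lam * D) ^ 2 ≤ 1 + 2 / n) (A : X ≃L[ℝ] E)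
    (hA : ∀ x, ‖x‖ ≤ ‖A x‖ ∧ ‖A x‖ ≤ D * ‖x‖) (x : σ → X) (hx : ∀ i, ‖x i‖ = 1)
    (hxx : ∀ i j, i ≠ j → ‖x i - x j‖ = lam) :
    ∃ p : X, ‖p‖ = 1 ∧ ∀ i, ‖p - x i‖ = lam := by
  classical
  have hsq : ∀ {r : ℝ}, 1 ≤ r → r ≤ lam * D → r ^ 2 ∈ Set.Icc (1 : ℝ) (1 + 2 / n) := fun h1 h2 =>
    ⟨one_le_pow₀ h1, (pow_le_pow_left₀ (by linarith) h2 2).trans hDlam⟩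
  obtain ⟨p, hpc, hp⟩ := exists_apex n hdim hcard (fun i => A (x i))
    (fun i => by
      have h := hA (x i)
      rw [hx i] at h
      exact hsq h.1 (by nlinarith [h.2]))
    (fun i j hij => by
      have h := hA (x i - x j)
      rw [hxx i j hij, map_sub] at h
      exact hsq (hlam.trans h.1) (by linarith [h.2]))
  let ρ : Option σ → ℝ := fun o => o.elim 1 fun _ => lam
  let v : Option σ → X := fun o => o.elim 0 x
  have hρ : ∀ o, 1 ≤ ρ o ∧ ρ o ≤ lam := by rintro (_ | i) <;> simp [ρ, hlam]
  let s : (Option σ → ℝ) → Option σ → ℝ := fun z o => (ρ o * (1 + z o * (D - 1))) ^ 2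
  have hdist : ∀ z ∈ Set.Icc (0 : Option σ → ℝ) 1, ∀ o,
      ‖A (A.symm (p (s z)) - v o)‖ = ρ o * (1 + z o * (D - 1)) := by
    intro z hz o
    have hb : ∀ o, 1 ≤ 1 + z o * (D - 1) ∧ 1 + z o * (D - 1) ≤ D := by
      intro o
      have h0 : 0 ≤ z o := hz.1 o
      have h1 : z o ≤ 1 := hz.2 o
      constructor <;> nlinarith
    have h := hp (s z) (fun o => hsq (one_le_mul_of_one_le_of_one_le (hρ o).1 (hb o).1)
      (mul_le_mul (hρ o).2 (hb o).2 (by linarith [hb o]) (by linarith))) o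
    have hv : A (v o) = o.elim 0 fun i => A (x i) := by rcases o with _ | i <;> simp [v]
    rw [map_sub, A.apply_symm_apply, hv]
    exact (pow_left_inj₀ (norm_nonneg _)
      (mul_nonneg (by linarith [hρ o]) (by linarith [hb o])) two_ne_zero).1 h
  obtain ⟨z, -, hz⟩ := poincare_miranda (fun o z => ‖A.symm (p (s z)) - v o‖ - ρ o)
    (fun o => by
      have hs : Continuous s := by fun_prop
      exact Continuous.continuousOn (by fun_prop))
    (fun o z hz h => by
      have h1 := (hA (A.symm (p (s z)) - v o)).1
      rw [hdist z hz o, h] at h1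
      linarith)
    (fun o z hz h => by
      have h1 := (hA (A.symm (p (s z)) - v o)).2
      rw [hdist z hz o, h] at h1
      have h2 : D * ρ o ≤ D * ‖A.symm (p (s z)) - v o‖ := by linarith
      have := le_of_mul_le_mul_left h2 (by linarith)
      linarith)
  refine ⟨A.symm (p (s z)), ?_, fun i => ?_⟩
  · have := hz none
    simp only [v, ρ, Option.elim, sub_zero] at this
    linarith
  · have := hz (some i)
    simp only [v, ρ, Option.elim] at this
    linarith

end EquilateralSets

theorem theorem2 (n : ℕ) (hn : 2 ≤ n) {X : Type*} [NormedAddCommGroup X] [NormedSpace ℝ X]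
    [FiniteDimensional ℝ X] (hdim : Module.finrank ℝ X = n)
    (hd : banachMazurDist X (EuclideanSpace ℝ (Fin n)) ≤ 1 + 1 / (3 * ((n : ℝ) + 1)))
    (lam : ℝ) (hlam : lam ∈ Set.Ioo (1 : ℝ) (1 + 1 / (3 * ((n : ℝ) + 1))))
    (S : Set X) (hS : S ⊆ Metric.sphere (0 : X) 1) (hSeq : IsEquilateralSet lam S)
    (hcard : S.encard ≤ ((n - 1 : ℕ) : ℕ∞)) :
    ∃ T : Set X, S ⊆ T ∧ T ⊆ Metric.sphere (0 : X) 1 ∧ IsEquilateralSet lam T ∧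
      T.encard = (n : ℕ∞) := by
  have : Nontrivial X := Module.nontrivial_of_finrank_pos (R := ℝ) (by omega)
  have hn2 : (2 : ℝ) ≤ n := by exact_mod_cast hn
  -- The infimum need not be known to be attained, so `D` = 1 + t is taken strictly above the bound
  -- on it. Then (λD)² ≤ (1 + t)⁴ ≤ 1 + 6t = 1 + 2/n, as t ≤ 1/6.
  set t : ℝ := 1 / (3 * n) with ht
  have htn : t * n = 1 / 3 := by rw [ht]; field_simp
  have ht0 : 0 < t := by positivity
  have ht1 : t ≤ 1 / 6 := by nlinarith
  have hlt : 1 / (3 * ((n : ℝ) + 1)) < t := by rw [ht]; gcongr; linarith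
  obtain ⟨A, hA⟩ := exists_continuousLinearEquiv_norm_bounds hdim (D := 1 + t) (by linarith)
  have hDlam : (lam * (1 + t)) ^ 2 ≤ 1 + 2 / n := by
    have h2n : (2 : ℝ) / n = 6 * t := by rw [ht]; field_simp; norm_num
    have h1 : lam * (1 + t) ≤ (1 + t) * (1 + t) := by
      gcongr; linarith [hlam.2]
    have h0 : 0 ≤ lam * (1 + t) := mul_nonneg (by linarith [hlam.1]) (by linarith)
    refine (pow_le_pow_left₀ h0 h1 2).trans ?_
    rw [h2n]
    have h2 : (1 + t) * (1 + t) ≤ 1 + 13 / 6 * t := by nlinarith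
    refine (pow_le_pow_left₀ (by positivity) h2 2).trans ?_
    nlinarith
  obtain ⟨hfin, hSn⟩ := Set.encard_le_coe_iff_finite_ncard_le.1 hcard
  suffices H : ∀ k : ℕ, S.ncard ≤ k → k ≤ n → ∃ T : Set X, S ⊆ T ∧ T ⊆ Metric.sphere (0 : X) 1 ∧
      IsEquilateralSet lam T ∧ T.encard = (k : ℕ∞) from H n (by omega) le_rfl
  intro k hk
  induction k, hk using Nat.le_induction with
  | base => exact fun _ => ⟨S, subset_rfl, hS, hSeq, hfin.cast_ncard_eq.symm⟩
  | succ k _ ih =>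
    intro hkn
    obtain ⟨T, hST, hT1, hTeq, hTk⟩ := ih (by omega)
    have hTfin : T.Finite := Set.finite_of_encard_eq_coe hTk
    have := hTfin.fintype
    have hTcard : Fintype.card T = k := by
      rw [Set.encard_eq_coe_toFinset_card, Set.toFinset_card] at hTk
      exact_mod_cast hTk
    obtain ⟨p, hp1, hpT⟩ := exists_norm_sub_eq (n := n) (σ := T) (by simp) (by omega)
      (by linarith : 1 ≤ 1 + t) hlam.1.le hDlam A hA (fun i => (i : X))
      (fun i => by simpa using hT1 i.2)
      (fun i j hij => hTeq.2 _ i.2 _ j.2 fun h => hij (Subtype.ext h))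
    have hpT' : ∀ y ∈ T, ‖p - y‖ = lam := fun y hy => hpT ⟨y, hy⟩
    have hpn : p ∉ T := fun h => by
      have := hpT' p h
      rw [sub_self, norm_zero] at this
      linarith [hlam.1]
    refine ⟨insert p T, hST.trans (Set.subset_insert _ _),
      Set.insert_subset (by simpa using hp1) hT1, ⟨hTeq.1, ?_⟩, ?_⟩
    · rintro x (rfl | hx) y (rfl | hy) hxy
      · exact absurd rfl hxy
      · exact hpT' y hy
      · rw [norm_sub_rev]; exact hpT' x hx
      · exact hTeq.2 x hx y hy hxy
    · rw [Set.encard_insert_of_notMem hpn, hTk]; push_cast; rfl
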